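/- Let $\Omega \subset \mathbb{R}^d$ be a bounded, Lebesgue measurable set with $m(\Omega) > 0$, where $m$ denotes Lebesgue measure. Suppose that there exists a Lebesgue measurable set $S \subset \mathbb{R}^d$ with the following properties: (i) $m(S) > 0$; (ii) $m(S \cap \Omega) = 0$; (iii) for every $x \in \mathbb{R}^d$, if $m((\Omega + x) \cap S) > 0$ then $m((\Omega + x) \cap \Omega) > 0$. Then $\Omega$ is not spectral, that is, there is no countable set $\Lambda \subset \mathbb{R}^d$ such that the exponential functions $e_\lambda(x) = e^{2\pi i \langle \lambda, x\rangle}$, $\lambda \in \Lambda$, are pairwise orthogonal and complete (have dense linear span) in $L^2(\Omega)$. -/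

import Mathlib

open MeasureTheory

noncomputable section

/-- The exponential function `e_ξ(x) = exp(2πi⟨ξ, x⟩)` on `ℝ^d`. -/
def expFun {d : ℕ} (ξ x : EuclideanSpace ℝ (Fin d)) : ℂ :=
  Complex.exp (2 * (Real.pi : ℂ) * Complex.I * ((inner ℝ ξ x : ℝ) : ℂ))

/-- On a bounded set, exponential functions are square integrable. -/
theorem memLp_expFun {d : ℕ} {Ω : Set (EuclideanSpace ℝ (Fin d))}
    (hΩ : Bornology.IsBounded Ω) (ξ : EuclideanSpace ℝ (Fin d)) :
    MemLp (expFun ξ) 2 (volume.restrict Ω) := by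
  haveI : IsFiniteMeasure (volume.restrict Ω) :=
    ⟨by simpa using hΩ.measure_lt_top⟩
  have hc : Continuous (expFun ξ) := by
    unfold expFun
    fun_prop
  refine MemLp.of_bound hc.aestronglyMeasurable 1 (Filter.Eventually.of_forall fun x => ?_)
  have h : (2 * (Real.pi : ℂ) * Complex.I * ((inner ℝ ξ x : ℝ) : ℂ))
      = ((2 * Real.pi * inner ℝ ξ x : ℝ) : ℂ) * Complex.I := by
    push_cast
    ring
  rw [expFun, h, Complex.norm_exp_ofReal_mul_I]

/-- The exponential `e_ξ`, restricted to the bounded set `Ω`, as an element of the Hilbert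
space `L²(Ω)`. -/
def expLp {d : ℕ} {Ω : Set (EuclideanSpace ℝ (Fin d))} (hΩ : Bornology.IsBounded Ω)
    (ξ : EuclideanSpace ℝ (Fin d)) : Lp ℂ 2 (volume.restrict Ω) :=
  (memLp_expFun hΩ ξ).toLp (expFun ξ)

/-- `Λ` is a spectrum for the bounded set `Ω`: it is countable, the exponentials `e_ξ`, `ξ ∈ Λ`,
are pairwise orthogonal in `L²(Ω)`, and they are complete there (their linear span is dense). -/
structure IsSpectrum {d : ℕ} {Ω : Set (EuclideanSpace ℝ (Fin d))} (hΩ : Bornology.IsBounded Ω)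
    (Λ : Set (EuclideanSpace ℝ (Fin d))) : Prop where
  countable : Λ.Countable
  orthogonal : ∀ ξ ∈ Λ, ∀ η ∈ Λ, ξ ≠ η → inner ℂ (expLp hΩ ξ) (expLp hΩ η) = 0
  complete : (Submodule.span ℂ (expLp hΩ '' Λ)).topologicalClosure = ⊤

/-- The bounded set `Ω` is spectral if it has a spectrum. (The notion is meant for sets of
positive measure.) -/
def IsSpectral {d : ℕ} {Ω : Set (EuclideanSpace ℝ (Fin d))} (hΩ : Bornology.IsBounded Ω) : Prop :=
  ∃ Λ : Set (EuclideanSpace ℝ (Fin d)), IsSpectrum hΩ Λ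

end

noncomputable section

/-! ### Exponentials and transforms of indicator functions. -/

section Exponentials

variable {d : ℕ}

/-! Suppose Λ is a spectrum of Ω, and for finite A ⊆ Λ let P_A be the squared modulus of the
exponential sum over A (`expSumSq`). The Fourier transform of x ↦ m((Ω + x) ∩ S) has a factor that
vanishes on nonzero differences of points of Λ, so only the diagonal terms of P_A contribute: ∫ m((Ω
+ x) ∩ S) P_A(x) dx = |A| m(S) m(Ω) for every measurable S of finite measure
(`integral_overlap_mul_expSumSq`). With weights P_A / (|A| m(Ω)), the translates of Ω thus tile
space. Heuristically, for large A these weights acquire a unit atom at 0, the copy Ω itself; the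
other translates carrying weight then do not overlap Ω and tile its complement. A set S outside Ω
would have to be covered by such translates, contrary to (iii).

No limit measure is needed. The absence of weight on translates that overlap Ω is expressed by ∫
m((Ω + x) ∩ Ω) D(x) P_A(x) dx ≤ η |A|, where D is `defect`, which vanishes at 0 and so ignores the
atom. By `integral_overlap_mul_defect_mul_expSumSq` this integral is the amount by which a sum over
pairs in A falls short of the total given by Parseval (`IsSpectrum.hasSum_powSpec`), that is, the
mass escaping from A. A Følner-type choice of A makes it small (`exists_finset_escaping_mass_le`).
In `not_exists_spectrum_of_overlap_pos_imp` a pointwise bound for m((Ω + x) ∩ S), integrated against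
P_A, gives the contradiction. -/

theorem expFun_eq (ξ x : EuclideanSpace ℝ (Fin d)) :
    expFun ξ x = Complex.exp (((2 * Real.pi * inner ℝ ξ x : ℝ) : ℂ) * Complex.I) := by
  unfold expFun
  congr 1
  push_cast
  ring

theorem norm_expFun (ξ x : EuclideanSpace ℝ (Fin d)) : ‖expFun ξ x‖ = 1 := by
  rw [expFun_eq, Complex.norm_exp_ofReal_mul_I]

theorem expFun_comm (ξ x : EuclideanSpace ℝ (Fin d)) : expFun ξ x = expFun x ξ := by
  rw [expFun, expFun, real_inner_comm]

theorem expFun_add_left (ξ η x : EuclideanSpace ℝ (Fin d)) :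
    expFun (ξ + η) x = expFun ξ x * expFun η x := by
  simp only [expFun, inner_add_left, Complex.ofReal_add, mul_add, Complex.exp_add]

theorem expFun_add_right (ξ x y : EuclideanSpace ℝ (Fin d)) :
    expFun ξ (x + y) = expFun ξ x * expFun ξ y := by
  simp only [expFun, inner_add_right, Complex.ofReal_add, mul_add, Complex.exp_add]

theorem expFun_zero_left (x : EuclideanSpace ℝ (Fin d)) : expFun 0 x = 1 := by
  simp [expFun]

theorem conj_expFun (ξ x : EuclideanSpace ℝ (Fin d)) :
    (starRingEnd ℂ) (expFun ξ x) = expFun (-ξ) x := by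
  rw [expFun_eq, expFun_eq, ← Complex.exp_conj, map_mul, Complex.conj_ofReal, Complex.conj_I,
    inner_neg_left]
  congr 1
  push_cast
  ring

theorem expFun_neg_right (ξ x : EuclideanSpace ℝ (Fin d)) :
    expFun ξ (-x) = expFun (-ξ) x := by
  simp [expFun]

theorem expFun_re (ξ x : EuclideanSpace ℝ (Fin d)) :
    (expFun ξ x).re = Real.cos (2 * Real.pi * inner ℝ ξ x) := by
  rw [expFun_eq, Complex.exp_ofReal_mul_I_re]

theorem continuous_expFun₂ :
    Continuous fun p : EuclideanSpace ℝ (Fin d) × EuclideanSpace ℝ (Fin d) => expFun p.1 p.2 := by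
  unfold expFun
  fun_prop

@[fun_prop]
theorem continuous_expFun (ξ : EuclideanSpace ℝ (Fin d)) : Continuous (expFun ξ) := by
  unfold expFun
  fun_prop

/-- The Fourier transform of the indicator function of `Ω`, up to the sign of the frequency. -/
def expInt (Ω : Set (EuclideanSpace ℝ (Fin d))) (ξ : EuclideanSpace ℝ (Fin d)) : ℂ :=
  ∫ x in Ω, expFun ξ x

/-- The power spectrum of `Ω`. -/
def powSpec (Ω : Set (EuclideanSpace ℝ (Fin d))) (ξ : EuclideanSpace ℝ (Fin d)) : ℝ :=
  ‖expInt Ω ξ‖ ^ 2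

/-- The measure of the intersection of the translate `Ω + x` with `S`. -/
def overlap (Ω S : Set (EuclideanSpace ℝ (Fin d))) (x : EuclideanSpace ℝ (Fin d)) : ℝ :=
  volume.real ((fun y => y - x) ⁻¹' Ω ∩ S)

theorem expInt_zero (Ω : Set (EuclideanSpace ℝ (Fin d))) : expInt Ω 0 = volume.real Ω := by
  simp [expInt, expFun_zero_left]

theorem expInt_neg (Ω : Set (EuclideanSpace ℝ (Fin d))) (ξ : EuclideanSpace ℝ (Fin d)) :
    expInt Ω (-ξ) = (starRingEnd ℂ) (expInt Ω ξ) := by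
  rw [expInt, expInt, ← integral_conj]
  simp_rw [conj_expFun]

theorem powSpec_neg (Ω : Set (EuclideanSpace ℝ (Fin d))) (ξ : EuclideanSpace ℝ (Fin d)) :
    powSpec Ω (-ξ) = powSpec Ω ξ := by
  rw [powSpec, powSpec, expInt_neg, RCLike.norm_conj]

theorem powSpec_nonneg (Ω : Set (EuclideanSpace ℝ (Fin d))) (ξ : EuclideanSpace ℝ (Fin d)) :
    0 ≤ powSpec Ω ξ := sq_nonneg _

theorem integrableOn_expFun {Ω : Set (EuclideanSpace ℝ (Fin d))} (hΩ : volume Ω ≠ ⊤)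
    (ξ : EuclideanSpace ℝ (Fin d)) : IntegrableOn (expFun ξ) Ω := by
  have : IsFiniteMeasure (volume.restrict Ω) := ⟨by simpa using hΩ.lt_top⟩
  exact Integrable.of_bound (continuous_expFun ξ).aestronglyMeasurable 1
    (Filter.Eventually.of_forall fun x => (norm_expFun ξ x).le)

theorem norm_expInt_le {Ω : Set (EuclideanSpace ℝ (Fin d))} (hΩ' : volume Ω ≠ ⊤)
    (x : EuclideanSpace ℝ (Fin d)) :
    ‖expInt Ω x‖ ≤ volume.real Ω := by
  have h := norm_setIntegral_le_of_norm_le_const hΩ'.lt_top (fun y _ => (norm_expFun x y).le)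
  rwa [one_mul] at h

theorem continuous_expInt {Ω : Set (EuclideanSpace ℝ (Fin d))} (hΩ : volume Ω ≠ ⊤) :
    Continuous (expInt Ω) := by
  have : IsFiniteMeasure (volume.restrict Ω) := ⟨by simpa using hΩ.lt_top⟩
  refine continuous_of_dominated (bound := fun _ => 1)
    (fun ξ => (continuous_expFun ξ).aestronglyMeasurable)
    (fun ξ => Filter.Eventually.of_forall fun x => (norm_expFun ξ x).le)
    (integrable_const _) (Filter.Eventually.of_forall fun x => ?_)
  simp_rw [fun ξ => expFun_comm ξ x]
  exact continuous_expFun x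

theorem continuous_powSpec {Ω : Set (EuclideanSpace ℝ (Fin d))} (hΩ : volume Ω ≠ ⊤) :
    Continuous (powSpec Ω) :=
  (continuous_expInt hΩ).norm.pow 2

end Exponentials

/-! ### Measures of overlaps of translates and their transforms. -/

section Overlap

variable {d : ℕ} {Ω S : Set (EuclideanSpace ℝ (Fin d))}

theorem overlap_nonneg (x : EuclideanSpace ℝ (Fin d)) : 0 ≤ overlap Ω S x :=
  measureReal_nonneg

theorem overlap_le_right (hS : volume S ≠ ⊤) (x : EuclideanSpace ℝ (Fin d)) :
    overlap Ω S x ≤ volume.real S :=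
  measureReal_mono Set.inter_subset_right hS

/-- Since e_η(y) e_η(x - y) = e_η(x), the character can be distributed over both convolution
factors; the integral of the left side then factors. -/
theorem overlap_mul_expFun (hΩ : MeasurableSet Ω) (hS : MeasurableSet S)
    (η x : EuclideanSpace ℝ (Fin d)) :
    (overlap Ω S x : ℂ) * expFun η x =
      convolution (S.indicator (expFun η)) ((Neg.neg ⁻¹' Ω).indicator (expFun η))
        (ContinuousLinearMap.mul ℝ ℂ) volume x := by
  have hm : MeasurableSet ((fun y => y - x) ⁻¹' Ω ∩ S) :=
    (hΩ.preimage (measurable_sub_const x)).inter hS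
  have h : ∀ y, (ContinuousLinearMap.mul ℝ ℂ) (S.indicator (expFun η) y)
      ((Neg.neg ⁻¹' Ω).indicator (expFun η) (x - y)) =
      ((fun y => y - x) ⁻¹' Ω ∩ S).indicator (fun _ => expFun η x) y := by
    intro y
    by_cases h1 : y ∈ S <;> by_cases h2 : y - x ∈ Ω <;>
      simp [Set.indicator, h1, h2, ← expFun_add_right]
  rw [convolution_def]
  simp_rw [h]
  rw [integral_indicator hm]
  simp [overlap]

theorem integrable_indicator_expFun (hS : MeasurableSet S) (hS' : volume S ≠ ⊤)
    (η : EuclideanSpace ℝ (Fin d)) : Integrable (S.indicator (expFun η)) :=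
  (integrableOn_expFun hS' η).integrable_indicator hS

theorem measure_neg_preimage_ne_top (hΩ' : volume Ω ≠ ⊤) : volume (Neg.neg ⁻¹' Ω) ≠ ⊤ := by
  rwa [Measure.measure_preimage_neg]

theorem integrable_overlap_mul_expFun (hΩ : MeasurableSet Ω) (hS : MeasurableSet S)
    (hΩ' : volume Ω ≠ ⊤) (hS' : volume S ≠ ⊤) (η : EuclideanSpace ℝ (Fin d)) :
    Integrable fun x => (overlap Ω S x : ℂ) * expFun η x := by
  simp_rw [overlap_mul_expFun hΩ hS]
  exact (integrable_indicator_expFun hS hS' η).integrable_convolution _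
    (integrable_indicator_expFun (hΩ.preimage measurable_neg)
      (measure_neg_preimage_ne_top hΩ') η)

theorem integral_overlap_mul_expFun (hΩ : MeasurableSet Ω) (hS : MeasurableSet S)
    (hΩ' : volume Ω ≠ ⊤) (hS' : volume S ≠ ⊤) (η : EuclideanSpace ℝ (Fin d)) :
    ∫ x, (overlap Ω S x : ℂ) * expFun η x = expInt S η * expInt Ω (-η) := by
  simp_rw [overlap_mul_expFun hΩ hS]
  rw [integral_convolution _ (integrable_indicator_expFun hS hS' η)
    (integrable_indicator_expFun (hΩ.preimage measurable_neg)
      (measure_neg_preimage_ne_top hΩ') η), integral_indicator hS]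
  simp only [ContinuousLinearMap.mul_apply']
  congr 1
  rw [expInt, ← integral_indicator hΩ, ← integral_neg_eq_self]
  congr 1
  ext x
  by_cases h : x ∈ Ω <;> simp [Set.indicator, h, expFun_neg_right]

theorem integrable_overlap (hΩ : MeasurableSet Ω) (hS : MeasurableSet S)
    (hΩ' : volume Ω ≠ ⊤) (hS' : volume S ≠ ⊤) : Integrable (overlap Ω S) := by
  have := (integrable_overlap_mul_expFun hΩ hS hΩ' hS' 0).re
  simpa [expFun_zero_left] using this

theorem integral_overlap_self_mul_expFun (hΩ : MeasurableSet Ω) (hΩ' : volume Ω ≠ ⊤)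
    (ξ : EuclideanSpace ℝ (Fin d)) :
    ∫ x, (overlap Ω Ω x : ℂ) * expFun ξ x = powSpec Ω ξ := by
  rw [integral_overlap_mul_expFun hΩ hΩ hΩ' hΩ', expInt_neg, powSpec, Complex.mul_conj,
    Complex.normSq_eq_norm_sq]

/-- Intersecting with S does not enlarge symmetric differences, and the symmetric difference of two
translates of Ω has small measure when the shifts are close. -/
theorem continuous_overlap (hΩ : MeasurableSet Ω) (hS : MeasurableSet S)
    (hΩ' : volume Ω ≠ ⊤) (hS' : volume S ≠ ⊤) : Continuous (overlap Ω S) := by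
  rw [continuous_iff_continuousAt]
  intro x₀
  have hc : Continuous fun x : EuclideanSpace ℝ (Fin d) =>
      (⟨fun y => y - x, by fun_prop⟩ :
        C(EuclideanSpace ℝ (Fin d), EuclideanSpace ℝ (Fin d))) :=
    ContinuousMap.continuous_of_continuous_uncurry _ (by
      change Continuous fun p : EuclideanSpace ℝ (Fin d) × EuclideanSpace ℝ (Fin d) => p.2 - p.1
      fun_prop)
  have key := tendsto_measure_symmDiff_preimage_nhds_zero (μ := volume) (ν := volume)
    (hc.tendsto x₀) (Filter.Eventually.of_forall fun x => measurePreserving_sub_right volume x)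
    (measurePreserving_sub_right volume x₀) hΩ.nullMeasurableSet hΩ'
  have key' := (ENNReal.tendsto_toReal ENNReal.zero_ne_top).comp key
  rw [ContinuousAt, tendsto_iff_dist_tendsto_zero]
  refine squeeze_zero (fun _ => dist_nonneg) (fun x => ?_) key'
  have hx : ∀ x, volume ((fun y => y - x) ⁻¹' Ω) ≠ ⊤ := fun x => by
    rwa [(measurePreserving_sub_right volume x).measure_preimage hΩ.nullMeasurableSet]
  have hm : ∀ x, MeasurableSet ((fun y => y - x) ⁻¹' Ω) := fun x =>
    hΩ.preimage (measurable_sub_const x)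
  have hfin : ∀ x, volume ((fun y => y - x) ⁻¹' Ω ∩ S) ≠ ⊤ := fun x =>
    measure_ne_top_of_subset Set.inter_subset_right hS'
  rw [Real.dist_eq]
  refine (abs_measureReal_sub_le_measureReal_symmDiff' ((hm x).inter hS).nullMeasurableSet
    ((hm x₀).inter hS).nullMeasurableSet (hfin x) (hfin x₀)).trans ?_
  refine measureReal_mono (fun y hy => ?_) (measure_ne_top_of_subset
    (s := (fun y => y - x) ⁻¹' Ω ∪ (fun y => y - x₀) ⁻¹' Ω) ?_
    (measure_union_lt_top (hx x).lt_top (hx x₀).lt_top).ne)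
  · rw [Set.mem_symmDiff] at hy
    rw [Set.mem_symmDiff]
    simp only [Set.mem_inter_iff, Set.mem_preimage, ContinuousMap.coe_mk] at hy ⊢
    tauto
  · exact symmDiff_le_sup

end Overlap

/-! ### Orthogonality, Parseval and separation for a spectrum. -/

section Spectrum

variable {d : ℕ} {Ω Λ : Set (EuclideanSpace ℝ (Fin d))}

theorem inner_expLp (hΩ : Bornology.IsBounded Ω) (ξ η : EuclideanSpace ℝ (Fin d)) :
    inner ℂ (expLp hΩ ξ) (expLp hΩ η) = expInt Ω (η - ξ) := by
  rw [L2.inner_def, expInt]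
  refine integral_congr_ae ?_
  filter_upwards [(memLp_expFun hΩ ξ).coeFn_toLp, (memLp_expFun hΩ η).coeFn_toLp] with x h1 h2
  rw [expLp, expLp, h1, h2, RCLike.inner_apply, conj_expFun, sub_eq_add_neg, expFun_add_left]

theorem IsSpectrum.expInt_sub_eq_zero {hΩ : Bornology.IsBounded Ω} (h : IsSpectrum hΩ Λ)
    {ξ η : EuclideanSpace ℝ (Fin d)} (hξ : ξ ∈ Λ) (hη : η ∈ Λ) (hne : ξ ≠ η) :
    expInt Ω (ξ - η) = 0 := by
  rw [← inner_expLp hΩ]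
  exact h.orthogonal η hη ξ hξ hne.symm

/-- Parseval's identity for the exponentials of a spectrum, applied to an exponential. -/
theorem IsSpectrum.hasSum_powSpec {hΩ : Bornology.IsBounded Ω} (h : IsSpectrum hΩ Λ)
    (hpos : 0 < volume.real Ω) (t : EuclideanSpace ℝ (Fin d)) :
    HasSum (fun l : Λ => powSpec Ω (t - l)) (volume.real Ω ^ 2) := by
  set c : ℝ := (Real.sqrt (volume.real Ω))⁻¹ with hc
  have hc2 : c * c = (volume.real Ω)⁻¹ := by
    rw [hc, ← mul_inv, Real.mul_self_sqrt hpos.le]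
  have hc0 : (c : ℂ) ≠ 0 := by
    rw [Complex.ofReal_ne_zero]
    exact inv_ne_zero (Real.sqrt_pos.2 hpos).ne'
  set v : Λ → Lp ℂ 2 (volume.restrict Ω) := fun l => (c : ℂ) • expLp hΩ l with hv
  have hon : Orthonormal ℂ v := by
    classical
    rw [orthonormal_iff_ite]
    intro i j
    simp only [hv, inner_smul_left, inner_smul_right, inner_expLp, Complex.conj_ofReal]
    split_ifs with hij
    · subst hij
      rw [sub_self, expInt_zero, ← mul_assoc, ← Complex.ofReal_mul, hc2, ← Complex.ofReal_mul,
        inv_mul_cancel₀ hpos.ne', Complex.ofReal_one]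
    · rw [h.expInt_sub_eq_zero j.2 i.2 fun e => hij (Subtype.ext e.symm)]
      simp
  have hsp : ⊤ ≤ (Submodule.span ℂ (Set.range v)).topologicalClosure := by
    rw [← h.complete]
    refine Submodule.topologicalClosure_mono (Submodule.span_le.2 ?_)
    rintro _ ⟨l, hl, rfl⟩
    have : expLp hΩ l = (c : ℂ)⁻¹ • v ⟨l, hl⟩ := by
      simp only [hv, smul_smul, inv_mul_cancel₀ hc0, one_smul]
    rw [this]
    exact Submodule.smul_mem _ _ (Submodule.subset_span ⟨_, rfl⟩)
  have key := (HilbertBasis.mk hon hsp).hasSum_inner_mul_inner (expLp hΩ t) (expLp hΩ t)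
  have hterm : ∀ l : Λ, inner ℂ (expLp hΩ t) (HilbertBasis.mk hon hsp l) *
      inner ℂ (HilbertBasis.mk hon hsp l) (expLp hΩ t) =
      (((volume.real Ω)⁻¹ * powSpec Ω (t - l) : ℝ) : ℂ) := by
    intro l
    rw [HilbertBasis.coe_mk]
    simp only [hv, inner_smul_left, inner_smul_right, inner_expLp, Complex.conj_ofReal]
    rw [← neg_sub t (l : EuclideanSpace ℝ (Fin d)), expInt_neg, powSpec, ← hc2]
    push_cast
    rw [← Complex.mul_conj']
    ring
  simp_rw [hterm] at key
  rw [inner_expLp, sub_self, expInt_zero] at key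
  have key' := (Complex.hasSum_ofReal.1 key).mul_left (volume.real Ω)
  simpa [mul_inv_cancel_left₀ hpos.ne', sq] using key'

/-- Points of a spectrum are separated. -/
theorem IsSpectrum.exists_separation {hΩ : Bornology.IsBounded Ω} (h : IsSpectrum hΩ Λ)
    (hpos : 0 < volume.real Ω) :
    ∃ δ > 0, ∀ ξ ∈ Λ, ∀ η ∈ Λ, ξ ≠ η → δ ≤ dist ξ η := by
  have hc := continuous_expInt (Ω := Ω) hΩ.measure_lt_top.ne
  have h0 : expInt Ω 0 ≠ 0 := by
    rw [expInt_zero]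
    exact_mod_cast hpos.ne'
  -- `expInt Ω` is nonzero near 0 but vanishes at differences of distinct points of Λ.
  obtain ⟨δ, hδ, hball⟩ := Metric.eventually_nhds_iff.1 (hc.continuousAt.eventually_ne h0)
  refine ⟨δ, hδ, fun ξ hξ η hη hne => ?_⟩
  by_contra! hlt
  refine hball (y := ξ - η) ?_ (h.expInt_sub_eq_zero hξ hη hne)
  rwa [dist_zero_right, ← dist_eq_norm]

end Spectrum

/-! ### Integrability of the power spectrum. -/

section PowerSpectrum

variable {d : ℕ} {Ω : Set (EuclideanSpace ℝ (Fin d))}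

/-- Fubini: the power spectrum is the transform of the self-overlap function, and the transform can
be moved onto g. -/
theorem integral_powSpec_mul (hΩ : MeasurableSet Ω) (hΩ' : volume Ω ≠ ⊤)
    {g : EuclideanSpace ℝ (Fin d) → ℂ} (hg : Integrable g) :
    ∫ ξ, (powSpec Ω ξ : ℂ) * g ξ = ∫ x, (overlap Ω Ω x : ℂ) * ∫ ξ, g ξ * expFun ξ x := by
  simp_rw [← integral_overlap_self_mul_expFun hΩ hΩ', ← integral_mul_const,
    ← integral_const_mul]
  rw [integral_integral_swap]
  · congr 1 with x
    congr 1 with ξ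
    ring
  · have hF : Integrable fun x => (overlap Ω Ω x : ℂ) :=
      (integrable_overlap hΩ hΩ hΩ' hΩ').ofReal
    have h := hg.mul_prod hF
    refine (h.bdd_mul (c := 1) continuous_expFun₂.aestronglyMeasurable
      (Filter.Eventually.of_forall fun p => (norm_expFun _ _).le)).congr
      (Filter.Eventually.of_forall fun p => ?_)
    simp only [Function.uncurry]
    ring_nf

theorem integral_gaussian_mul_expFun {b : ℝ} (hb : 0 < b) (x : EuclideanSpace ℝ (Fin d)) :
    ∫ ξ, (Real.exp (-b * ‖ξ‖ ^ 2) : ℂ) * expFun ξ x =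
      ((Real.pi / b) ^ (d / 2 : ℝ) * Real.exp (-(Real.pi ^ 2 / b) * ‖x‖ ^ 2) : ℝ) := by
  have h := GaussianFourier.integral_cexp_neg_mul_sq_norm_add (V := EuclideanSpace ℝ (Fin d))
    (b := b) (by simpa using hb) (2 * Real.pi * Complex.I) x
  have h1 : ∀ ξ : EuclideanSpace ℝ (Fin d), (Real.exp (-b * ‖ξ‖ ^ 2) : ℂ) * expFun ξ x =
      Complex.exp (-b * ‖ξ‖ ^ 2 + 2 * Real.pi * Complex.I * inner ℝ x ξ) := by
    intro ξ
    rw [Complex.exp_add, expFun, real_inner_comm]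
    push_cast
    rfl
  simp_rw [h1]
  rw [h, Complex.ofReal_mul, Complex.ofReal_cpow (by positivity)]
  simp only [finrank_euclideanSpace, Fintype.card_fin]
  push_cast
  congr 2
  have : (b : ℂ) ≠ 0 := by exact_mod_cast hb.ne'
  field_simp
  rw [Complex.I_sq]
  ring

theorem integrable_gaussian {b : ℝ} (hb : 0 < b) :
    Integrable fun ξ : EuclideanSpace ℝ (Fin d) => Real.exp (-b * ‖ξ‖ ^ 2) := by
  have h := GaussianFourier.integrable_cexp_neg_mul_sq_norm_add
    (V := EuclideanSpace ℝ (Fin d)) (b := b) (by simpa using hb) 0 0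
  refine h.re.congr (Filter.Eventually.of_forall fun ξ => ?_)
  simp only [zero_mul, add_zero]
  rw [← Complex.ofReal_neg, ← Complex.ofReal_pow, ← Complex.ofReal_mul, ← Complex.ofReal_exp]
  rfl

theorem powSpec_le (hΩ' : volume Ω ≠ ⊤) (ξ : EuclideanSpace ℝ (Fin d)) :
    powSpec Ω ξ ≤ volume.real Ω ^ 2 :=
  pow_le_pow_left₀ (norm_nonneg _) (norm_expInt_le hΩ' ξ) 2

/-- The transform of the Gaussian is a Gaussian of total mass 1, here integrated against an overlap
that is at most m(Ω). The bound does not depend on b, which is what integrability of the power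
spectrum requires. -/
theorem integral_powSpec_mul_gaussian_le (hΩ : MeasurableSet Ω) (hΩ' : volume Ω ≠ ⊤) {b : ℝ}
    (hb : 0 < b) : ∫ ξ, powSpec Ω ξ * Real.exp (-b * ‖ξ‖ ^ 2) ≤ volume.real Ω := by
  have hb' : 0 < Real.pi ^ 2 / b := by positivity
  have hg : Integrable fun ξ : EuclideanSpace ℝ (Fin d) => (Real.exp (-b * ‖ξ‖ ^ 2) : ℂ) :=
    (integrable_gaussian hb).ofReal
  have key := integral_powSpec_mul hΩ hΩ' hg
  simp_rw [integral_gaussian_mul_expFun hb, ← Complex.ofReal_mul] at key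
  rw [integral_complex_ofReal, integral_complex_ofReal, Complex.ofReal_inj] at key
  rw [key]
  have hint : Integrable fun x : EuclideanSpace ℝ (Fin d) =>
      (Real.pi / b) ^ (d / 2 : ℝ) * Real.exp (-(Real.pi ^ 2 / b) * ‖x‖ ^ 2) :=
    (integrable_gaussian hb').const_mul _
  calc
    _ ≤ ∫ x : EuclideanSpace ℝ (Fin d), volume.real Ω *
        ((Real.pi / b) ^ (d / 2 : ℝ) * Real.exp (-(Real.pi ^ 2 / b) * ‖x‖ ^ 2)) := by
      refine integral_mono_of_nonneg (Filter.Eventually.of_forall fun x => ?_)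
        (hint.const_mul _) (Filter.Eventually.of_forall fun x => ?_)
      · have := overlap_nonneg (Ω := Ω) (S := Ω) x
        positivity
      · exact mul_le_mul_of_nonneg_right (overlap_le_right hΩ' x) (by positivity)
    _ = volume.real Ω := by
      rw [integral_const_mul, integral_const_mul, GaussianFourier.integral_rexp_neg_mul_sq_norm hb',
        finrank_euclideanSpace, Fintype.card_fin, ← Real.mul_rpow (by positivity) (by positivity)]
      have : Real.pi / b * (Real.pi / (Real.pi ^ 2 / b)) = 1 := by
        field_simp
      rw [this, Real.one_rpow, mul_one]

theorem integrable_powSpec (hΩ : MeasurableSet Ω) (hΩ' : volume Ω ≠ ⊤) :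
    Integrable (powSpec Ω) := by
  have hloc : ∀ r : ℝ, IntegrableOn (powSpec Ω) (Metric.ball 0 r) := fun r =>
    ((continuous_powSpec hΩ').locallyIntegrable.integrableOn_isCompact
      (isCompact_closedBall 0 r)).mono_set Metric.ball_subset_closedBall
  refine (aecover_ball (x := (0 : EuclideanSpace ℝ (Fin d))) Filter.tendsto_id
    ).integrable_of_integral_bounded_of_nonneg_ae (Real.exp 1 * volume.real Ω) hloc
    (Filter.Eventually.of_forall (powSpec_nonneg Ω)) ?_
  filter_upwards [Filter.eventually_gt_atTop 0] with r hr
  -- With b = 1/r² the Gaussian is at least 1/e on the ball of radius r, hence the constant e in the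
  -- uniform bound.
  have hb : 0 < (r ^ 2)⁻¹ := by positivity
  have hint : Integrable fun ξ => powSpec Ω ξ * Real.exp (-(r ^ 2)⁻¹ * ‖ξ‖ ^ 2) :=
    (integrable_gaussian hb).bdd_mul (c := volume.real Ω ^ 2)
      (continuous_powSpec hΩ').aestronglyMeasurable (Filter.Eventually.of_forall fun ξ => by
        rw [Real.norm_of_nonneg (powSpec_nonneg Ω ξ)]
        exact powSpec_le hΩ' ξ)
  calc
    ∫ ξ in Metric.ball 0 (id r), powSpec Ω ξ
      ≤ ∫ ξ in Metric.ball 0 r,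
          Real.exp 1 * (powSpec Ω ξ * Real.exp (-(r ^ 2)⁻¹ * ‖ξ‖ ^ 2)) := by
      refine setIntegral_mono_on (hloc r) (hint.integrableOn.const_mul _) measurableSet_ball
        fun ξ hξ => ?_
      have h1 : 1 ≤ Real.exp 1 * Real.exp (-(r ^ 2)⁻¹ * ‖ξ‖ ^ 2) := by
        rw [← Real.exp_add]
        refine Real.one_le_exp ?_
        have h2 : ‖ξ‖ ^ 2 ≤ r ^ 2 :=
          pow_le_pow_left₀ (norm_nonneg _) (mem_ball_zero_iff.1 hξ).le 2
        have h3 : (r ^ 2)⁻¹ * ‖ξ‖ ^ 2 ≤ 1 := by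
          rw [inv_mul_le_iff₀ (by positivity)]
          simpa using h2
        linarith
      nlinarith [powSpec_nonneg Ω ξ]
    _ ≤ ∫ ξ, Real.exp 1 * (powSpec Ω ξ * Real.exp (-(r ^ 2)⁻¹ * ‖ξ‖ ^ 2)) := by
      refine setIntegral_le_integral (hint.const_mul _)
        (Filter.Eventually.of_forall fun ξ => ?_)
      have := powSpec_nonneg Ω ξ
      positivity
    _ ≤ Real.exp 1 * volume.real Ω := by
      rw [integral_const_mul]
      exact mul_le_mul_of_nonneg_left (integral_powSpec_mul_gaussian_le hΩ hΩ' hb)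
        (Real.exp_pos _).le

end PowerSpectrum

/-! ### Separated sets and a Følner-type choice of finite subsets. -/

section Averaging

/-- Otherwise N would grow at least like (1 + η)^k, which exceeds any polynomial. -/
theorem exists_succ_le_mul_of_polynomial_growth {N : ℕ → ℝ} {C : ℝ} {d : ℕ} (h0 : 1 ≤ N 0)
    (hN : ∀ k, N k ≤ C * (k + 1) ^ d) {η : ℝ} (hη : 0 < η) :
    ∃ k, N (k + 1) ≤ (1 + η) * N k := by
  by_contra! hcon
  have hlow : ∀ k, (1 + η) ^ k ≤ N k := by
    intro k
    induction k with
    | zero => simpa using h0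
    | succ k ih =>
      rw [pow_succ']
      exact (mul_le_mul_of_nonneg_left ih (by positivity)).trans (hcon k).le
  have hlim : Filter.Tendsto (fun k : ℕ => C * (1 + η) * ((k + 1 : ℕ) ^ d / (1 + η) ^ (k + 1)))
      Filter.atTop (nhds (C * (1 + η) * 0)) :=
    ((tendsto_pow_const_div_const_pow_of_one_lt d (by linarith : 1 < 1 + η)).comp
      (Filter.tendsto_add_atTop_nat 1)).const_mul _
  rw [mul_zero] at hlim
  obtain ⟨k, hk⟩ := (hlim.eventually (gt_mem_nhds one_pos)).exists
  have h1 := (hlow k).trans (hN k)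
  have h2 : 0 < (1 + η) ^ k := by positivity
  have h3 : C * (1 + η) * ((k + 1 : ℕ) ^ d / (1 + η) ^ (k + 1)) =
      C * (k + 1) ^ d / (1 + η) ^ k := by
    rw [pow_succ]
    push_cast
    field_simp
  rw [h3, div_lt_one h2] at hk
  linarith

variable {d : ℕ} {Λ : Set (EuclideanSpace ℝ (Fin d))} {ρ : ℝ}
  {K : EuclideanSpace ℝ (Fin d) → ℝ}

theorem pairwiseDisjoint_ball_sub {T : Finset (EuclideanSpace ℝ (Fin d))} (hT : ↑T ⊆ Λ)
    (hsep : ∀ ξ ∈ Λ, ∀ η ∈ Λ, ξ ≠ η → 2 * ρ ≤ dist ξ η) (c : EuclideanSpace ℝ (Fin d)) :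
    (↑T : Set (EuclideanSpace ℝ (Fin d))).PairwiseDisjoint fun l => Metric.ball (l - c) ρ := by
  intro a ha b hb hab
  refine Metric.ball_disjoint_ball ?_
  rw [dist_sub_right, ← two_mul]
  exact hsep a (hT ha) b (hT hb) hab

theorem sum_setIntegral_ball_le (hK : Integrable K) (hK0 : ∀ x, 0 ≤ K x)
    (hsep : ∀ ξ ∈ Λ, ∀ η ∈ Λ, ξ ≠ η → 2 * ρ ≤ dist ξ η)
    {T : Finset (EuclideanSpace ℝ (Fin d))} (hT : ↑T ⊆ Λ) (c : EuclideanSpace ℝ (Fin d))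
    {U : Set (EuclideanSpace ℝ (Fin d))} (hTU : ∀ l ∈ T, Metric.ball (l - c) ρ ⊆ U) :
    ∑ l ∈ T, ∫ x in Metric.ball (l - c) ρ, K x ≤ ∫ x in U, K x := by
  rw [← integral_biUnion_finset T (fun _ _ => measurableSet_ball)
    (pairwiseDisjoint_ball_sub hT hsep c) (fun _ _ => hK.integrableOn)]
  refine setIntegral_mono_set hK.integrableOn (Filter.Eventually.of_forall hK0) ?_
  exact (Set.iUnion₂_subset hTU).eventuallyLE

/-- Packing: the balls of radius ρ about the points are disjoint and lie in the ball of radius R +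
ρ. This is the case of an indicator K in `sum_setIntegral_ball_le`. -/
theorem card_mul_volume_ball_le
    (hsep : ∀ ξ ∈ Λ, ∀ η ∈ Λ, ξ ≠ η → 2 * ρ ≤ dist ξ η)
    {T : Finset (EuclideanSpace ℝ (Fin d))} {R : ℝ} (hT : ↑T ⊆ Λ ∩ Metric.ball 0 R) :
    T.card * volume.real (Metric.ball (0 : EuclideanSpace ℝ (Fin d)) ρ) ≤
      volume.real (Metric.ball (0 : EuclideanSpace ℝ (Fin d)) (R + ρ)) := by
  have hK : Integrable ((Metric.ball (0 : EuclideanSpace ℝ (Fin d)) (R + ρ)).indicator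
      fun _ => (1 : ℝ)) :=
    (integrable_indicator_iff measurableSet_ball).2
      (integrableOn_const measure_ball_lt_top.ne)
  have hsub : ∀ l ∈ T, Metric.ball (l - 0) ρ ⊆
      Metric.ball (0 : EuclideanSpace ℝ (Fin d)) (R + ρ) := fun l hl =>
    Metric.ball_subset_ball' (by
      have := Metric.mem_ball.1 (hT hl).2
      rw [sub_zero]
      linarith)
  have key := sum_setIntegral_ball_le hK
    (fun x => Set.indicator_nonneg (fun _ _ => zero_le_one) x) hsep
    (fun l hl => (hT hl).1) 0 hsub
  rw [setIntegral_indicator measurableSet_ball, Set.inter_self] at key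
  have hterm : ∀ l ∈ T, ∫ x in Metric.ball (l - 0) ρ,
      (Metric.ball (0 : EuclideanSpace ℝ (Fin d)) (R + ρ)).indicator (fun _ => (1 : ℝ)) x =
      volume.real (Metric.ball (0 : EuclideanSpace ℝ (Fin d)) ρ) := by
    intro l hl
    rw [setIntegral_indicator measurableSet_ball, Set.inter_eq_left.2 (hsub l hl),
      setIntegral_const, smul_eq_mul, mul_one, Measure.real, Measure.addHaar_ball_center,
      Measure.real]
  rw [Finset.sum_congr rfl hterm] at key
  simpa using key

theorem finite_inter_ball (hρ : 0 < ρ)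
    (hsep : ∀ ξ ∈ Λ, ∀ η ∈ Λ, ξ ≠ η → 2 * ρ ≤ dist ξ η) (R : ℝ) :
    (Λ ∩ Metric.ball 0 R).Finite := by
  by_contra hinf
  have hv : 0 < volume.real (Metric.ball (0 : EuclideanSpace ℝ (Fin d)) ρ) :=
    ENNReal.toReal_pos (Metric.measure_ball_pos volume _ hρ).ne' measure_ball_lt_top.ne
  obtain ⟨n, hn⟩ := exists_nat_gt
    (volume.real (Metric.ball (0 : EuclideanSpace ℝ (Fin d)) (R + ρ)) /
      volume.real (Metric.ball (0 : EuclideanSpace ℝ (Fin d)) ρ))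
  obtain ⟨T, hT, hcard⟩ := Set.Infinite.exists_subset_card_eq hinf n
  have := card_mul_volume_ball_le hsep hT
  rw [div_lt_iff₀ hv, ← hcard] at hn
  linarith

theorem setIntegral_ball_eq_add {F : Type*} [NormedAddCommGroup F] [NormedSpace ℝ F]
    (f : EuclideanSpace ℝ (Fin d) → F) (ξ : EuclideanSpace ℝ (Fin d)) :
    ∫ x in Metric.ball ξ ρ, f x = ∫ t in Metric.ball 0 ρ, f (t + ξ) := by
  rw [← (measurePreserving_add_right volume ξ).setIntegral_preimage_emb
    (measurableEmbedding_addRight ξ)]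
  congr 2
  ext t
  simp [dist_eq_norm]

theorem setIntegral_ball_neg (heven : ∀ x, K (-x) = K x) (ξ : EuclideanSpace ℝ (Fin d)) :
    ∫ x in Metric.ball (-ξ) ρ, K x = ∫ x in Metric.ball ξ ρ, K x := by
  rw [← (Measure.measurePreserving_neg volume).setIntegral_preimage_emb
    (MeasurableEquiv.neg _).measurableEmbedding]
  simp [heven]

/-- Evenness turns each term into the integral of K(t + c - l) over t in a fixed ball; sum and
integral are then exchanged, and the inner sum is κ. Separation and integrability of K give the
summability. -/
theorem hasSum_setIntegral_ball (hΛ : Λ.Countable) (hK : Integrable K) (hK0 : ∀ x, 0 ≤ K x)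
    (heven : ∀ x, K (-x) = K x)
    (hsep : ∀ ξ ∈ Λ, ∀ η ∈ Λ, ξ ≠ η → 2 * ρ ≤ dist ξ η) {κ : ℝ}
    (hsum : ∀ t, HasSum (fun l : Λ => K (t - l)) κ) (c : EuclideanSpace ℝ (Fin d)) :
    HasSum (fun l : Λ => ∫ x in Metric.ball ((l : EuclideanSpace ℝ (Fin d)) - c) ρ, K x)
      (volume.real (Metric.ball (0 : EuclideanSpace ℝ (Fin d)) ρ) * κ) := by
  have : Countable Λ := hΛ.to_subtype
  have hterm : ∀ l : Λ, ∫ x in Metric.ball ((l : EuclideanSpace ℝ (Fin d)) - c) ρ, K x =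
      ∫ t in Metric.ball 0 ρ, K (t + c - l) := by
    intro l
    rw [← setIntegral_ball_neg heven, setIntegral_ball_eq_add]
    congr 1
    ext t
    congr 1
    abel
  have hsummable : Summable fun l : Λ =>
      ∫ x in Metric.ball ((l : EuclideanSpace ℝ (Fin d)) - c) ρ, K x := by
    refine summable_of_sum_le (c := ∫ x, K x)
      (fun l => setIntegral_nonneg measurableSet_ball fun x _ => hK0 x) fun T => ?_
    have h := sum_setIntegral_ball_le hK hK0 hsep (T := T.map (Function.Embedding.subtype _))
      (U := Set.univ) (by intro x; simp +contextual) c fun _ _ => Set.subset_univ _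
    simpa using h
  simp_rw [hterm] at hsummable ⊢
  have h := hasSum_integral_of_summable_integral_norm
    (μ := volume.restrict (Metric.ball (0 : EuclideanSpace ℝ (Fin d)) ρ))
    (F := fun (l : Λ) t => K (t + c - l))
    (fun l => by
      have := hK.comp_add_right (c - l)
      simp_rw [← add_sub_assoc] at this
      exact this.integrableOn)
    (by simpa only [Real.norm_of_nonneg (hK0 _)] using hsummable)
  simp_rw [fun t => (hsum (t + c)).tsum_eq] at h
  simpa using h

/-- A separated set whose translates of `K` sum to a constant has large finite subsets from which
only a small proportion of the mass escapes. -/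
theorem exists_finset_escaping_mass_le (hρ : 0 < ρ) (hΛ : Λ.Countable) (hΛ0 : Λ.Nonempty)
    (hK : Integrable K) (hK0 : ∀ x, 0 ≤ K x) (heven : ∀ x, K (-x) = K x)
    (hsep : ∀ ξ ∈ Λ, ∀ η ∈ Λ, ξ ≠ η → 2 * ρ ≤ dist ξ η) {κ : ℝ}
    (hsum : ∀ t, HasSum (fun l : Λ => K (t - l)) κ) {η : ℝ} (hη : 0 < η) :
    ∃ A : Finset (EuclideanSpace ℝ (Fin d)), ↑A ⊆ Λ ∧ A.Nonempty ∧
      A.card * (volume.real (Metric.ball (0 : EuclideanSpace ℝ (Fin d)) ρ) * κ) -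
        ∑ a ∈ A, ∑ b ∈ A, ∫ x in Metric.ball (b - a) ρ, K x ≤ η * A.card := by
  classical
  set J : EuclideanSpace ℝ (Fin d) → ℝ := fun ξ => ∫ x in Metric.ball ξ ρ, K x with hJ
  have hJ0 : ∀ ξ, 0 ≤ J ξ := fun ξ => setIntegral_nonneg measurableSet_ball fun x _ => hK0 x
  obtain ⟨r, hr0, hr⟩ : ∃ r > 0, ∫ x in (Metric.ball 0 r)ᶜ, K x < η / 2 := by
    have h := (aecover_ball (x := (0 : EuclideanSpace ℝ (Fin d)))
      Filter.tendsto_id).integral_tendsto_of_countably_generated hK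
    obtain ⟨r, hr1, hr2⟩ := ((h.eventually (lt_mem_nhds
      (by linarith : (∫ x, K x) - η / 2 < ∫ x, K x))).and
      (Filter.eventually_gt_atTop 0)).exists
    refine ⟨r, hr2, ?_⟩
    rw [setIntegral_compl measurableSet_ball hK]
    simp only [id] at hr1
    linarith
  obtain ⟨l₀, hl₀⟩ := hΛ0
  -- The increment r + ρ ensures that, for a in `A k` and b in Λ outside `A (k + 1)`, the ball of
  -- radius ρ about b - a misses the ball of radius r about 0. The offset ‖l₀‖ + 1 puts l₀ into `A
  -- 0`.
  set R : ℕ → ℝ := fun k => ‖l₀‖ + 1 + k * (r + ρ) with hR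
  have hfin : ∀ k, (Λ ∩ Metric.ball 0 (R k)).Finite := fun k => finite_inter_ball hρ hsep _
  set A : ℕ → Finset (EuclideanSpace ℝ (Fin d)) := fun k => (hfin k).toFinset with hA
  have hmem : ∀ k l, l ∈ A k ↔ l ∈ Λ ∧ ‖l‖ < R k := by
    intro k l
    simp [hA]
  have hl₀A : ∀ k, l₀ ∈ A k := by
    intro k
    rw [hmem]
    have : 0 ≤ k * (r + ρ) := by positivity
    exact ⟨hl₀, by simp only [hR]; linarith⟩
  have hI : 0 ≤ ∫ x, K x := integral_nonneg hK0
  have hv : 0 < volume.real (Metric.ball (0 : EuclideanSpace ℝ (Fin d)) ρ) :=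
    ENNReal.toReal_pos (Metric.measure_ball_pos volume _ hρ).ne' measure_ball_lt_top.ne
  have hgrowth : ∀ k, ((A k).card : ℝ) ≤
      (‖l₀‖ + 1 + (r + ρ) + ρ) ^ d *
        volume.real (Metric.ball (0 : EuclideanSpace ℝ (Fin d)) 1) /
        volume.real (Metric.ball (0 : EuclideanSpace ℝ (Fin d)) ρ) * (k + 1) ^ d := by
    intro k
    have h := card_mul_volume_ball_le hsep (T := A k) (R := R k) (by simp [hA])
    have hRk : 0 < R k + ρ := by positivity
    rw [measureReal_def volume (Metric.ball 0 (R k + ρ)), Measure.addHaar_ball_of_pos _ _ hRk,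
      ENNReal.toReal_mul, ENNReal.toReal_ofReal (by positivity), ← measureReal_def, finrank_euclideanSpace, Fintype.card_fin] at h
    rw [div_mul_eq_mul_div, le_div_iff₀ hv, mul_right_comm, ← mul_pow]
    refine h.trans (mul_le_mul_of_nonneg_right (pow_le_pow_left₀ hRk.le ?_ d) measureReal_nonneg)
    have h1 : 0 ≤ ‖l₀‖ := norm_nonneg _
    have h2 : 0 ≤ (k : ℝ) := Nat.cast_nonneg k
    simp only [hR]
    nlinarith [mul_nonneg h1 h2, mul_nonneg h2 hρ.le]
  -- The ratio is chosen so that the shell contributes at most (η/2)|A k|; the + 1 keeps the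
  -- denominator positive when ∫ K = 0.
  obtain ⟨k, hk⟩ := exists_succ_le_mul_of_polynomial_growth (N := fun k => ((A k).card : ℝ))
    (by exact_mod_cast Finset.card_pos.2 ⟨l₀, hl₀A 0⟩) hgrowth
    (η := η / (2 * (∫ x, K x) + 1)) (by positivity)
  have hsub : A k ⊆ A (k + 1) := by
    intro l hl
    rw [hmem] at hl ⊢
    refine ⟨hl.1, hl.2.trans_le ?_⟩
    simp only [hR]
    push_cast
    nlinarith
  refine ⟨A k, fun l hl => ((hmem k l).1 hl).1, ⟨l₀, hl₀A k⟩, ?_⟩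
  have hAΛ : ∀ k, (↑(A k) : Set (EuclideanSpace ℝ (Fin d))) ⊆ Λ :=
    fun k l hl => ((hmem k l).1 hl).1
  -- For a fixed a, frequencies outside `A (k + 1)` contribute disjoint balls outside the ball of
  -- radius r, where K has mass below η/2.
  have hlocal : ∀ a ∈ A k, volume.real (Metric.ball (0 : EuclideanSpace ℝ (Fin d)) ρ) * κ ≤
      ∑ b ∈ A (k + 1), J (b - a) + η / 2 := by
    intro a ha
    refine hasSum_le_of_sum_le (hasSum_setIntegral_ball hΛ hK hK0 heven hsep hsum a) fun T => ?_
    set T' := T.map (Function.Embedding.subtype _) with hT'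
    have hTΛ : (↑T' : Set (EuclideanSpace ℝ (Fin d))) ⊆ Λ := by
      intro x
      simp +contextual [hT']
    have e1 : ∑ l ∈ T, ∫ x in Metric.ball ((l : EuclideanSpace ℝ (Fin d)) - a) ρ, K x =
        ∑ b ∈ T', J (b - a) := by
      rw [hT', Finset.sum_map]
      rfl
    rw [e1, ← Finset.sum_filter_add_sum_filter_not T' (fun b => b ∈ A (k + 1))]
    refine add_le_add (Finset.sum_le_sum_of_subset_of_nonneg ?_ fun b _ _ => hJ0 _) ?_
    · intro b hb
      exact (Finset.mem_filter.1 hb).2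
    · refine (sum_setIntegral_ball_le hK hK0 hsep (U := (Metric.ball 0 r)ᶜ)
        (fun b hb => hTΛ (Finset.mem_filter.1 hb).1) a fun b hb x hx hx' => ?_).trans hr.le
      have hb' := Finset.mem_filter.1 hb
      refine hb'.2 ((hmem _ _).2 ⟨hTΛ hb'.1, ?_⟩)
      have h1 := ((hmem _ _).1 ha).2
      rw [mem_ball_zero_iff] at hx'
      rw [mem_ball_iff_norm] at hx
      have h2 : b = a + x - (x - (b - a)) := by abel
      have h3 : ‖b‖ ≤ ‖a‖ + ‖x‖ + ‖x - (b - a)‖ := by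
        conv_lhs => rw [h2]
        exact (norm_sub_le _ _).trans (add_le_add_left (norm_add_le _ _) _)
      simp only [hR] at h1 ⊢
      push_cast
      linarith
  -- Summing over a first, each b in the shell costs at most the whole mass of K.
  have hshell : ∑ a ∈ A k, ∑ b ∈ A (k + 1) \ A k, J (b - a) ≤
      ((A (k + 1)).card - (A k).card) * ∫ x, K x := by
    rw [Finset.sum_comm]
    calc
      _ ≤ ∑ b ∈ A (k + 1) \ A k, ∫ x, K x := by
        refine Finset.sum_le_sum fun b _ => ?_
        have h := sum_setIntegral_ball_le hK hK0 hsep (hAΛ k) b (U := Set.univ)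
          fun _ _ => Set.subset_univ _
        rw [setIntegral_univ] at h
        refine le_trans (le_of_eq (Finset.sum_congr rfl fun a _ => ?_)) h
        simp only [hJ]
        rw [← neg_sub, setIntegral_ball_neg heven]
      _ = _ := by
        rw [Finset.sum_const, nsmul_eq_mul, Finset.card_sdiff_of_subset hsub,
          Nat.cast_sub (Finset.card_le_card hsub)]
  have htotal := Finset.sum_le_sum hlocal
  simp_rw [← Finset.sum_sdiff hsub, Finset.sum_add_distrib, Finset.sum_const, nsmul_eq_mul]
    at htotal
  have hcard : (((A (k + 1)).card : ℝ) - (A k).card) * ∫ x, K x ≤ η / 2 * (A k).card := by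
    have h1 : ((A (k + 1)).card : ℝ) - (A k).card ≤
        η / (2 * (∫ x, K x) + 1) * (A k).card := by linarith
    refine (mul_le_mul_of_nonneg_right h1 hI).trans ?_
    rw [div_mul_eq_mul_div, div_mul_eq_mul_div, div_le_iff₀ (by positivity)]
    have : 0 ≤ η * (A k).card := by positivity
    nlinarith
  linarith

end Averaging

/-! ### Integrals against squared exponential sums. -/

section TrigonometricSums

variable {d : ℕ}

/-- The squared modulus of the exponential sum with frequencies in `A`. -/
def expSumSq (A : Finset (EuclideanSpace ℝ (Fin d))) (x : EuclideanSpace ℝ (Fin d)) : ℝ :=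
  ‖∑ a ∈ A, expFun a x‖ ^ 2

theorem expSumSq_nonneg (A : Finset (EuclideanSpace ℝ (Fin d))) (x : EuclideanSpace ℝ (Fin d)) :
    0 ≤ expSumSq A x := sq_nonneg _

theorem ofReal_expSumSq (A : Finset (EuclideanSpace ℝ (Fin d))) (x : EuclideanSpace ℝ (Fin d)) :
    (expSumSq A x : ℂ) = ∑ a ∈ A, ∑ b ∈ A, expFun (b - a) x := by
  rw [expSumSq, Complex.ofReal_pow, ← Complex.conj_mul', map_sum, Finset.sum_mul_sum]
  simp_rw [conj_expFun, ← expFun_add_left, neg_add_eq_sub]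

theorem continuous_expSumSq (A : Finset (EuclideanSpace ℝ (Fin d))) :
    Continuous (expSumSq A) := by
  unfold expSumSq
  fun_prop

theorem expSumSq_le (A : Finset (EuclideanSpace ℝ (Fin d))) (x : EuclideanSpace ℝ (Fin d)) :
    expSumSq A x ≤ (A.card : ℝ) ^ 2 := by
  refine pow_le_pow_left₀ (norm_nonneg _) ((norm_sum_le _ _).trans ?_) 2
  simp [norm_expFun]

theorem MeasureTheory.Integrable.mul_expSumSq {W : EuclideanSpace ℝ (Fin d) → ℝ}
    (hW : Integrable W) (A : Finset (EuclideanSpace ℝ (Fin d))) :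
    Integrable fun x => W x * expSumSq A x :=
  hW.mul_bdd (c := (A.card : ℝ) ^ 2) (continuous_expSumSq A).aestronglyMeasurable
    (Filter.Eventually.of_forall fun x => by
      rw [Real.norm_of_nonneg (expSumSq_nonneg A x)]
      exact expSumSq_le A x)

theorem integral_mul_expSumSq {W : EuclideanSpace ℝ (Fin d) → ℂ} (hW : Integrable W)
    (A : Finset (EuclideanSpace ℝ (Fin d))) :
    ∫ x, W x * (expSumSq A x : ℂ) = ∑ a ∈ A, ∑ b ∈ A, ∫ x, W x * expFun (b - a) x := by
  have hint : ∀ ξ, Integrable fun x => W x * expFun ξ x := fun ξ =>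
    hW.mul_bdd (c := 1) (continuous_expFun ξ).aestronglyMeasurable
      (Filter.Eventually.of_forall fun x => (norm_expFun ξ x).le)
  simp_rw [ofReal_expSumSq, Finset.mul_sum]
  rw [integral_finsetSum _ fun a _ => integrable_finsetSum _ fun b _ => hint _]
  refine Finset.sum_congr rfl fun a _ => ?_
  rw [integral_finsetSum _ fun b _ => hint _]

variable {Ω S Λ : Set (EuclideanSpace ℝ (Fin d))}

/-- The exponential sums with frequencies in a spectrum of `Ω` are weak tilings by `-Ω`. -/
theorem integral_overlap_mul_expSumSq (hΩ : MeasurableSet Ω) (hS : MeasurableSet S)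
    (hΩ' : volume Ω ≠ ⊤) (hS' : volume S ≠ ⊤)
    (horth : ∀ ξ ∈ Λ, ∀ η ∈ Λ, ξ ≠ η → expInt Ω (ξ - η) = 0)
    {A : Finset (EuclideanSpace ℝ (Fin d))} (hA : ↑A ⊆ Λ) :
    ∫ x, overlap Ω S x * expSumSq A x = A.card * (volume.real S * volume.real Ω) := by
  have hF : Integrable fun x => (overlap Ω S x : ℂ) := (integrable_overlap hΩ hS hΩ' hS').ofReal
  have key := integral_mul_expSumSq hF A
  simp_rw [integral_overlap_mul_expFun hΩ hS hΩ' hS', neg_sub] at key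
  have hterm : ∀ a ∈ A, ∑ b ∈ A, expInt S (b - a) * expInt Ω (a - b) =
      ((volume.real S * volume.real Ω : ℝ) : ℂ) := by
    intro a ha
    rw [Finset.sum_eq_single_of_mem a ha]
    · rw [sub_self, expInt_zero, expInt_zero, Complex.ofReal_mul]
    · intro b hb hba
      rw [horth a (hA ha) b (hA hb) hba.symm, mul_zero]
  rw [Finset.sum_congr rfl hterm, Finset.sum_const, nsmul_eq_mul] at key
  exact_mod_cast key

/-- A function with nonnegative values which vanishes only at the origin. -/
def defect (ρ : ℝ) (x : EuclideanSpace ℝ (Fin d)) : ℝ :=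
  volume.real (Metric.ball (0 : EuclideanSpace ℝ (Fin d)) ρ) - (expInt (Metric.ball 0 ρ) x).re

theorem continuous_defect (ρ : ℝ) : Continuous (defect (d := d) ρ) :=
  continuous_const.sub (Complex.continuous_re.comp (continuous_expInt measure_ball_lt_top.ne))

theorem defect_nonneg (ρ : ℝ) (x : EuclideanSpace ℝ (Fin d)) : 0 ≤ defect ρ x :=
  sub_nonneg.2 ((Complex.re_le_norm _).trans (norm_expInt_le measure_ball_lt_top.ne x))

theorem defect_pos {ρ : ℝ} (hρ : 0 < ρ) {x : EuclideanSpace ℝ (Fin d)} (hx : x ≠ 0) :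
    0 < defect ρ x := by
  refine (defect_nonneg ρ x).lt_of_ne' fun h0 => ?_
  have hint := integrableOn_expFun (Ω := Metric.ball (0 : EuclideanSpace ℝ (Fin d)) ρ)
    measure_ball_lt_top.ne x
  have hint' : IntegrableOn (fun t => (1 : ℝ) - (expFun x t).re) (Metric.ball 0 ρ) :=
    (integrableOn_const measure_ball_lt_top.ne).sub hint.re
  have hnn : ∀ t, 0 ≤ (1 : ℝ) - (expFun x t).re := fun t =>
    sub_nonneg.2 ((Complex.re_le_norm _).trans (norm_expFun x t).le)
  have heq : defect ρ x = ∫ t in Metric.ball 0 ρ, ((1 : ℝ) - (expFun x t).re) := by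
    have hone : IntegrableOn (fun _ => (1 : ℝ))
        (Metric.ball (0 : EuclideanSpace ℝ (Fin d)) ρ) :=
      integrableOn_const measure_ball_lt_top.ne
    have hre := integral_re hint
    have hint_re := hint.re
    simp only [RCLike.re_eq_complex_re] at hre hint_re
    rw [integral_sub hone hint_re, hre, defect, expInt]
    simp
  rw [heq, integral_eq_zero_iff_of_nonneg hnn hint'] at h0
  have hzero := Measure.eqOn_open_of_ae_eq h0 Metric.isOpen_ball
    (by fun_prop) continuousOn_const
  have hxn : 0 < ‖x‖ := norm_pos_iff.2 hx
  -- If the integral vanished, Re e_x would be identically 1 on the ball. The test point c • x lies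
  -- in the ball by the first bound, and the second puts its phase 2πc‖x‖² in (0, π], where cos < 1.
  set c : ℝ := min (ρ / 2 / ‖x‖) (1 / 2 / ‖x‖ ^ 2) with hc
  have hcpos : 0 < c := lt_min (by positivity) (by positivity)
  have hmem : c • x ∈ Metric.ball (0 : EuclideanSpace ℝ (Fin d)) ρ := by
    rw [mem_ball_zero_iff, norm_smul, Real.norm_of_nonneg hcpos.le]
    have := (le_div_iff₀ hxn).1 (min_le_left (ρ / 2 / ‖x‖) (1 / 2 / ‖x‖ ^ 2))
    linarith
  have h1 := hzero hmem
  simp only [Pi.zero_apply, expFun_re, inner_smul_right, real_inner_self_eq_norm_sq] at h1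
  have hle : c * ‖x‖ ^ 2 ≤ 1 / 2 := (le_div_iff₀ (by positivity)).1 (min_le_right _ _)
  have hlo : 0 < c * ‖x‖ ^ 2 := by positivity
  have hpi := Real.pi_pos
  have hcos : Real.cos (2 * Real.pi * (c * ‖x‖ ^ 2)) < Real.cos 0 :=
    Real.cos_lt_cos_of_nonneg_of_le_pi le_rfl (by nlinarith) (by positivity)
  rw [Real.cos_zero] at hcos
  linarith

/-- Multiplying the self-overlap by the transform of a ball averages its transform, the power
spectrum, over a translate of that ball. -/
theorem integral_overlap_mul_expInt_ball (hΩ : MeasurableSet Ω) (hΩ' : volume Ω ≠ ⊤) (ρ : ℝ)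
    (ξ : EuclideanSpace ℝ (Fin d)) :
    ∫ x, (overlap Ω Ω x : ℂ) * expInt (Metric.ball 0 ρ) x * expFun ξ x =
      ((∫ t in Metric.ball ξ ρ, powSpec Ω t : ℝ) : ℂ) := by
  have hg : Integrable ((Metric.ball ξ ρ).indicator fun _ => (1 : ℂ)) :=
    (integrable_indicator_iff measurableSet_ball).2 (integrableOn_const measure_ball_lt_top.ne)
  have key := integral_powSpec_mul hΩ hΩ' hg
  have h1 : ∀ t, (powSpec Ω t : ℂ) * (Metric.ball ξ ρ).indicator (fun _ => (1 : ℂ)) t =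
      (Metric.ball ξ ρ).indicator (fun t => (powSpec Ω t : ℂ)) t := by
    intro t
    by_cases h : t ∈ Metric.ball ξ ρ <;> simp [h]
  have h2 : ∀ x, ∫ t, (Metric.ball ξ ρ).indicator (fun _ => (1 : ℂ)) t * expFun t x =
      expInt (Metric.ball 0 ρ) x * expFun ξ x := by
    intro x
    have h3 : ∀ t, (Metric.ball ξ ρ).indicator (fun _ => (1 : ℂ)) t * expFun t x =
        (Metric.ball ξ ρ).indicator (expFun x) t := by
      intro t
      by_cases h : t ∈ Metric.ball ξ ρ <;> simp [h, expFun_comm t x]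
    simp_rw [h3]
    rw [integral_indicator measurableSet_ball, setIntegral_ball_eq_add, expInt,
      ← integral_mul_const]
    simp_rw [expFun_add_right, expFun_comm x ξ]
  simp_rw [h1, h2] at key
  rw [integral_indicator measurableSet_ball, integral_complex_ofReal] at key
  rw [key]
  simp_rw [mul_assoc]

theorem integrable_overlap_mul_defect (hΩ : MeasurableSet Ω) (hΩ' : volume Ω ≠ ⊤) (ρ : ℝ) :
    Integrable fun x => overlap Ω Ω x * defect ρ x :=
  (integrable_overlap hΩ hΩ hΩ' hΩ').mul_bdd
    (c := 2 * volume.real (Metric.ball (0 : EuclideanSpace ℝ (Fin d)) ρ))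
    (continuous_defect ρ).aestronglyMeasurable
    (Filter.Eventually.of_forall fun x => by
      have h1 := norm_expInt_le (Ω := Metric.ball (0 : EuclideanSpace ℝ (Fin d)) ρ)
        measure_ball_lt_top.ne x
      have h2 := (abs_le.1 ((Complex.abs_re_le_norm _).trans h1)).1
      rw [Real.norm_of_nonneg (defect_nonneg ρ x), defect]
      linarith)

/-- The constant part of `defect` gives the tiling identity with S = Ω; the other part expands into
averages of the power spectrum over balls at differences of A. -/
theorem integral_overlap_mul_defect_mul_expSumSq (hΩ : MeasurableSet Ω) (hΩ' : volume Ω ≠ ⊤)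
    (horth : ∀ ξ ∈ Λ, ∀ η ∈ Λ, ξ ≠ η → expInt Ω (ξ - η) = 0)
    {A : Finset (EuclideanSpace ℝ (Fin d))} (hA : ↑A ⊆ Λ) (ρ : ℝ) :
    ∫ x, overlap Ω Ω x * defect ρ x * expSumSq A x =
      A.card * (volume.real (Metric.ball (0 : EuclideanSpace ℝ (Fin d)) ρ) *
        volume.real Ω ^ 2) -
      ∑ a ∈ A, ∑ b ∈ A, ∫ t in Metric.ball (b - a) ρ, powSpec Ω t := by
  have hF := integrable_overlap hΩ hΩ hΩ' hΩ'
  have hF' : Integrable fun x => (overlap Ω Ω x : ℂ) := hF.ofReal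
  have hW : Integrable fun x => (overlap Ω Ω x : ℂ) * expInt (Metric.ball 0 ρ) x :=
    hF'.mul_bdd (c := volume.real (Metric.ball (0 : EuclideanSpace ℝ (Fin d)) ρ))
      (continuous_expInt measure_ball_lt_top.ne).aestronglyMeasurable
      (Filter.Eventually.of_forall (norm_expInt_le measure_ball_lt_top.ne))
  have hWP : Integrable fun x =>
      (overlap Ω Ω x : ℂ) * expInt (Metric.ball 0 ρ) x * (expSumSq A x : ℂ) :=
    hW.mul_bdd (c := (A.card : ℝ) ^ 2)
      (Complex.continuous_ofReal.comp (continuous_expSumSq A)).aestronglyMeasurable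
      (Filter.Eventually.of_forall fun x => by
        rw [Complex.norm_real, Real.norm_of_nonneg (expSumSq_nonneg A x)]
        exact expSumSq_le A x)
  have key := integral_mul_expSumSq hW A
  simp_rw [integral_overlap_mul_expInt_ball hΩ hΩ'] at key
  have hre : ∀ x, overlap Ω Ω x * defect ρ x * expSumSq A x =
      volume.real (Metric.ball (0 : EuclideanSpace ℝ (Fin d)) ρ) *
        (overlap Ω Ω x * expSumSq A x) -
      ((overlap Ω Ω x : ℂ) * expInt (Metric.ball 0 ρ) x * (expSumSq A x : ℂ)).re := by
    intro x
    rw [Complex.re_mul_ofReal, Complex.re_ofReal_mul, defect]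
    ring
  have hre' := integral_re hWP
  have hWP' := hWP.re
  simp only [RCLike.re_eq_complex_re] at hre' hWP'
  simp_rw [hre]
  rw [integral_sub ((hF.mul_expSumSq A).const_mul _) hWP', hre', integral_const_mul,
    integral_overlap_mul_expSumSq hΩ hΩ hΩ' hΩ' horth hA]
  congr 1
  · ring
  · rw [key]
    norm_cast

end TrigonometricSums

/-! ### The contradiction, and reduction to bounded Borel sets. -/

section NonSpectral

variable {d : ℕ} {Ω S : Set (EuclideanSpace ℝ (Fin d))}

/-- A translate of Ω meeting S is shifted by at most 2R, so it stays inside the ball of radius 3R.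
Hence the overlap with that ball dominates the indicator of {overlap Ω S > 0}, up to the factor
m(Ω). -/
theorem overlap_eq_of_overlap_pos (hΩ : MeasurableSet Ω) {R : ℝ} (hΩR : Ω ⊆ Metric.ball 0 R)
    (hSR : S ⊆ Metric.ball 0 R) {x : EuclideanSpace ℝ (Fin d)} (hx : 0 < overlap Ω S x) :
    ‖x‖ ≤ 2 * R ∧ overlap Ω (Metric.ball 0 (3 * R)) x = volume.real Ω := by
  have hne : ((fun y => y - x) ⁻¹' Ω ∩ S).Nonempty := by
    by_contra h
    rw [Set.not_nonempty_iff_eq_empty] at h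
    rw [overlap, h, measureReal_empty] at hx
    exact hx.false
  obtain ⟨y, hy1, hy2⟩ := hne
  have h1 := mem_ball_zero_iff.1 (hΩR hy1)
  have h2 := mem_ball_zero_iff.1 (hSR hy2)
  have h3 : ‖x‖ ≤ 2 * R := by
    have := norm_sub_le y (y - x)
    rw [sub_sub_cancel] at this
    linarith
  refine ⟨h3, ?_⟩
  rw [overlap, Set.inter_eq_left.2, Measure.real,
    (measurePreserving_sub_right volume x).measure_preimage hΩ.nullMeasurableSet, Measure.real]
  intro z hz
  have h4 := mem_ball_zero_iff.1 (hΩR hz)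
  rw [mem_ball_zero_iff]
  have := norm_add_le (z - x) x
  rw [sub_add_cancel] at this
  linarith

theorem not_exists_spectrum_of_overlap_pos_imp (hΩb : Bornology.IsBounded Ω)
    (hΩ : MeasurableSet Ω) (hΩpos : 0 < volume.real Ω) (hSb : Bornology.IsBounded S)
    (hS : MeasurableSet S) (hSpos : 0 < volume.real S) (hzero : overlap Ω S 0 = 0)
    (himp : ∀ x, 0 < overlap Ω S x → 0 < overlap Ω Ω x)
    {Λ : Set (EuclideanSpace ℝ (Fin d))} : ¬ IsSpectrum hΩb Λ := by
  intro hΛ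
  have hΩ' : volume Ω ≠ ⊤ := hΩb.measure_lt_top.ne
  have hS' : volume S ≠ ⊤ := hSb.measure_lt_top.ne
  have horth : ∀ ξ ∈ Λ, ∀ η ∈ Λ, ξ ≠ η → expInt Ω (ξ - η) = 0 :=
    fun ξ hξ η hη => hΛ.expInt_sub_eq_zero hξ hη
  have hsum := hΛ.hasSum_powSpec hΩpos
  obtain ⟨δ, hδ, hsep⟩ := hΛ.exists_separation hΩpos
  have hne : Λ.Nonempty := by
    by_contra h
    rw [Set.not_nonempty_iff_eq_empty] at h
    subst h
    have := (hsum 0).unique hasSum_empty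
    exact (pow_pos hΩpos 2).ne' this
  obtain ⟨R, hR⟩ := (hΩb.union hSb).subset_ball 0
  have hΩR : Ω ⊆ Metric.ball 0 R := Set.subset_union_left.trans hR
  have hSR : S ⊆ Metric.ball 0 R := Set.subset_union_right.trans hR
  set m := volume.real Ω with hm
  set s := volume.real S with hs
  set B : Set (EuclideanSpace ℝ (Fin d)) := Metric.ball 0 (3 * R) with hB
  set v := volume.real B with hv
  have hv0 : 0 ≤ v := measureReal_nonneg
  have hB' : volume B ≠ ⊤ := measure_ball_lt_top.ne
  set ρ := δ / 2 with hρ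
  -- Small enough that shifts with overlap below ε account for at most a quarter of |A| s m; the + 1
  -- avoids having to prove v > 0.
  set ε := s * m / (4 * (v + 1)) with hε
  have hε0 : 0 < ε := by positivity
  have hεv : ε * v ≤ s * m / 4 := by
    rw [hε, div_mul_eq_mul_div, div_le_div_iff₀ (by positivity) (by norm_num)]
    have : 0 < s * m := by positivity
    nlinarith
  have hG := continuous_overlap hΩ hS hΩ' hS'
  have hcompact : IsCompact {x | ε ≤ overlap Ω S x} := by
    refine (isCompact_closedBall 0 (2 * R)).of_isClosed_subset
      (isClosed_le continuous_const hG) fun x hx => ?_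
    rw [mem_closedBall_zero_iff]
    exact (overlap_eq_of_overlap_pos hΩ hΩR hSR (hε0.trans_le hx)).1
  -- Hypothesis (iii) enters here. The compact set omits 0 because S and Ω are essentially disjoint,
  -- so both factors are positive on it and have a uniform lower bound.
  obtain ⟨c, hc0, hc⟩ := hcompact.exists_forall_le'
    (f := fun x => overlap Ω Ω x * defect ρ x)
    ((continuous_overlap hΩ hΩ hΩ' hΩ').mul (continuous_defect ρ)).continuousOn
    (a := 0) fun x hx => by
      have hx0 : 0 < overlap Ω S x := hε0.trans_le hx
      refine mul_pos (himp x hx0) (defect_pos (by positivity) ?_)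
      rintro rfl
      exact hx0.ne' hzero
  obtain ⟨A, hAΛ, hA0, hA⟩ := exists_finset_escaping_mass_le (ρ := ρ) (by positivity)
    hΛ.countable hne (integrable_powSpec hΩ hΩ') (powSpec_nonneg Ω) (powSpec_neg Ω)
    (by simpa only [hρ, mul_div_cancel₀ δ (two_ne_zero' ℝ)] using hsep) hsum
    -- After multiplication by s/c below, the escaping mass is also at most a quarter of |A| s m.
    (η := c * m / 4) (by positivity)
  rw [← integral_overlap_mul_defect_mul_expSumSq hΩ hΩ' horth hAΛ ρ] at hA
  -- The first term handles 0 < overlap < ε, where the overlap with B is m; the second handles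
  -- overlap ≥ ε. Integrated against P_A, this yields |A| s m ≤ |A| s m / 2.
  have hpt : ∀ x, overlap Ω S x ≤
      ε / m * overlap Ω B x + s / c * (overlap Ω Ω x * defect ρ x) := by
    intro x
    have h1 : 0 ≤ ε / m * overlap Ω B x := mul_nonneg (by positivity) (overlap_nonneg x)
    have h2 : 0 ≤ s / c * (overlap Ω Ω x * defect ρ x) :=
      mul_nonneg (by positivity) (mul_nonneg (overlap_nonneg x) (defect_nonneg ρ x))
    rcases le_or_gt ε (overlap Ω S x) with h | h
    · have h3 : s ≤ s / c * (overlap Ω Ω x * defect ρ x) := by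
        rw [div_mul_eq_mul_div, le_div_iff₀ hc0]
        exact mul_le_mul_of_nonneg_left (hc x h) hSpos.le
      linarith [overlap_le_right (Ω := Ω) hS' x]
    · rcases (overlap_nonneg (Ω := Ω) (S := S) x).eq_or_lt with h3 | h3
      · linarith
      · rw [(overlap_eq_of_overlap_pos hΩ hΩR hSR h3).2, div_mul_cancel₀ _ hΩpos.ne']
        linarith
  have hi1 := (integrable_overlap hΩ hS hΩ' hS').mul_expSumSq A
  have hi2 := (integrable_overlap hΩ measurableSet_ball hΩ' hB').mul_expSumSq A
  have hi3 := (integrable_overlap_mul_defect hΩ hΩ' ρ).mul_expSumSq A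
  have hint : ∫ x, overlap Ω S x * expSumSq A x ≤
      ∫ x, (ε / m * (overlap Ω B x * expSumSq A x) +
        s / c * (overlap Ω Ω x * defect ρ x * expSumSq A x)) := by
    refine integral_mono hi1 ((hi2.const_mul _).add (hi3.const_mul _)) fun x => ?_
    refine (mul_le_mul_of_nonneg_right (hpt x) (expSumSq_nonneg A x)).trans_eq ?_
    ring
  rw [integral_add (hi2.const_mul _) (hi3.const_mul _), integral_const_mul, integral_const_mul,
    integral_overlap_mul_expSumSq hΩ hS hΩ' hS' horth hAΛ,
    integral_overlap_mul_expSumSq hΩ measurableSet_ball hΩ' hB' horth hAΛ] at hint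
  have hN : (0 : ℝ) < A.card := by exact_mod_cast hA0.card_pos
  have h1 : ε / m * (A.card * (v * m)) = A.card * (ε * v) := by
    field_simp
  have h2 := mul_le_mul_of_nonneg_left hA (by positivity : 0 ≤ s / c)
  have h3 : s / c * (c * m / 4 * A.card) = A.card * (s * m / 4) := by
    field_simp
  have h4 := mul_le_mul_of_nonneg_left hεv hN.le
  have h5 : 0 < A.card * (s * m) := by positivity
  rw [← hm, ← hs, ← hB, ← hv, h1] at hint
  rw [h3] at h2
  linarith

theorem IsSpectrum.congr_set {Ω' : Set (EuclideanSpace ℝ (Fin d))}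
    {Λ : Set (EuclideanSpace ℝ (Fin d))} {hΩ : Bornology.IsBounded Ω}
    (h : IsSpectrum hΩ Λ) (hΩ' : Bornology.IsBounded Ω')
    (heq : volume.restrict Ω = volume.restrict Ω') : IsSpectrum hΩ' Λ := by
  -- The L² space depends on the measure as a type, so the measure is generalized and the equality
  -- substituted instead of rewritten.
  have main : ∀ (μ : Measure (EuclideanSpace ℝ (Fin d))), volume.restrict Ω = μ →
      ∀ hμ : ∀ ξ, MemLp (expFun ξ) 2 μ,
      (∀ ξ ∈ Λ, ∀ η ∈ Λ, ξ ≠ η →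
        inner ℂ ((hμ ξ).toLp (expFun ξ)) ((hμ η).toLp (expFun η)) = 0) ∧
      (Submodule.span ℂ ((fun ξ => (hμ ξ).toLp (expFun ξ)) '' Λ)).topologicalClosure = ⊤ := by
    rintro _ rfl hμ
    exact ⟨h.orthogonal, h.complete⟩
  obtain ⟨h1, h2⟩ := main _ heq (memLp_expFun hΩ')
  exact ⟨h.countable, h1, h2⟩

end NonSpectral

end

/-- `NullMeasurableSet _ volume` is Lebesgue measurability; `(fun y => y + x) '' Ω` is the
translate `Ω + x`. -/
theorem theorem3p5 (d : ℕ) (Ω : Set (EuclideanSpace ℝ (Fin d)))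
    (hΩ : Bornology.IsBounded Ω) (hΩm : NullMeasurableSet Ω volume)
    (hΩpos : 0 < volume Ω)
    (hS : ∃ S : Set (EuclideanSpace ℝ (Fin d)), NullMeasurableSet S volume ∧
      0 < volume S ∧ volume (S ∩ Ω) = 0 ∧
      ∀ x : EuclideanSpace ℝ (Fin d),
        0 < volume (((fun y => y + x) '' Ω) ∩ S) → 0 < volume (((fun y => y + x) '' Ω) ∩ Ω)) :
    ¬ IsSpectral hΩ := by
  rintro ⟨Λ, hΛ⟩
  obtain ⟨S, hSm, hSpos, hSΩ, himp⟩ := hS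
  -- Borel subsets of full measure, with S further cut down to a bounded piece of positive measure.
  -- Shrinking S preserves (ii) and (iii), and null changes of Ω affect neither the overlaps nor
  -- L²(Ω).
  obtain ⟨Ω₀, hΩ₀sub, hΩ₀, hΩ₀eq⟩ := hΩm.exists_measurable_subset_ae_eq
  obtain ⟨S₀, hS₀sub, hS₀, hS₀eq⟩ := hSm.exists_measurable_subset_ae_eq
  have hΩ₀b : Bornology.IsBounded Ω₀ := hΩ.subset hΩ₀sub
  obtain ⟨n, hn⟩ : ∃ n : ℕ, 0 < volume (S₀ ∩ Metric.ball 0 n) := by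
    by_contra! h
    have h0 : volume (⋃ n : ℕ, S₀ ∩ Metric.ball 0 n) = 0 :=
      measure_iUnion_null fun n => le_zero_iff.1 (h n)
    rw [← Set.inter_iUnion, Metric.iUnion_ball_nat, Set.inter_univ, measure_congr hS₀eq] at h0
    exact hSpos.ne' h0
  have hsub : S₀ ∩ Metric.ball 0 n ⊆ S := Set.inter_subset_left.trans hS₀sub
  have hS₁b : Bornology.IsBounded (S₀ ∩ Metric.ball 0 n) :=
    Metric.isBounded_ball.subset Set.inter_subset_right
  refine not_exists_spectrum_of_overlap_pos_imp hΩ₀b hΩ₀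
    (ENNReal.toReal_pos (by rw [measure_congr hΩ₀eq]; exact hΩpos.ne') hΩ₀b.measure_lt_top.ne)
    hS₁b (hS₀.inter measurableSet_ball) (ENNReal.toReal_pos hn.ne' hS₁b.measure_lt_top.ne)
    ?_ (fun x hx => ?_) (hΛ.congr_set hΩ₀b (Measure.restrict_congr_set hΩ₀eq.symm))
  · simp only [overlap, sub_zero, Set.preimage_id', Measure.real]
    rw [measure_mono_null _ hSΩ, ENNReal.toReal_zero]
    exact fun y hy => ⟨hsub hy.2, hΩ₀sub hy.1⟩
  · have h1 : 0 < volume (((fun y => y + x) '' Ω) ∩ S) := by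
      refine (ENNReal.toReal_pos_iff.1 hx).1.trans_le (measure_mono fun y hy => ⟨?_, hsub hy.2⟩)
      exact ⟨y - x, hΩ₀sub hy.1, sub_add_cancel y x⟩
    have h2 := himp x h1
    have h3 : (fun y => y + x) '' Ω = (fun y => y - x) ⁻¹' Ω := by
      ext y
      constructor
      · rintro ⟨z, hz, rfl⟩
        simpa using hz
      · intro hy
        exact ⟨y - x, hy, sub_add_cancel y x⟩
    rw [h3] at h2
    have h4 : ((fun y => y - x) ⁻¹' Ω₀ ∩ Ω₀ : Set (EuclideanSpace ℝ (Fin d))) =ᵐ[volume]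
        ((fun y => y - x) ⁻¹' Ω ∩ Ω : Set (EuclideanSpace ℝ (Fin d))) :=
      ((measurePreserving_sub_right volume x).quasiMeasurePreserving.preimage_ae_eq
        hΩ₀eq).inter hΩ₀eq
    refine ENNReal.toReal_pos ?_ (measure_ne_top_of_subset Set.inter_subset_right
      hΩ₀b.measure_lt_top.ne)
    rw [measure_congr h4]
    exact h2.ne'
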